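/- Let $\mathcal C$ be a braided monoidal category such that - (1*) $\mathcal C$ has all small colimits; - (2*) $\mathcal C$ has all finite and all countable limits; - (3*) $\mathcal C$ is (ExtrEpi, Mono)-structured: every morphism $f$ of $\mathcal C$ can be written as $f = me$ with $e$ an extremal epimorphism and $m$ a monomorphism, and for every commutative square $mf = ge$ with $e$ an extremal epimorphism and $m$ a monomorphism there is a morphism $t$ with $te = f$ and $mt = g$ (an epimorphism $e$ is called extremal if in every factorization $e = ih$ with $i$ a monomorphism, $i$ is an isomorphism); - (4) $\mathcal C$ is wellpowered: for every object $M$ the equivalence classes of monomorphisms to $M$ form a small set; - (5) for every monomorphism $f$ and every object $M$ both $f \otimes \mathrm{id}_M$ and $\mathrm{id}_M \otimes f$ are monomorphisms; - (10*) the forgetful functor $\mathsf{Comon}(\mathcal C) \to \mathcal C$ from the category of comonoids in $\mathcal C$ has a right adjoint. Let $\mathsf{Bimon}(\mathcal C)$ be the category of bimonoids in $\mathcal C$, and let $\mathsf{Hopf}(\mathcal C)$ be the category of Hopf monoids in $\mathcal C$, i.e. of the bimonoids $H$ for which $\mathrm{id}_H$ has an inverse (the antipode) in the convolution monoid $\mathcal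 C(H,H)$, with all bimonoid homomorphisms between them. Then the forgetful functor $\mathsf{Hopf}(\mathcal C) \to \mathsf{Bimon}(\mathcal C)$ has a right adjoint $H_r \colon \mathsf{Bimon}(\mathcal C) \to \mathsf{Hopf}(\mathcal C)$. In particular, $\mathsf{Hopf}(\mathcal C)$ is a coreflective subcategory of $\mathsf{Bimon}(\mathcal C)$. -/

import Mathlib

open CategoryTheory MonoidalCategory Limits

universe w v u

namespace CategoryTheory

/-- `C` is (ExtrEpi, Mono)-structured: every morphism is an extremal epimorphism followed by a
monomorphism, and every commutative square with an extremal epimorphism on the left and a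
monomorphism on the right has a diagonal fill-in. -/
structure ExtrEpiMonoStructured (C : Type u) [Category.{v} C] : Prop where
  exists_factorization : ∀ {X Y : C} (f : X ⟶ Y),
    ∃ (Z : C) (e : X ⟶ Z) (m : Z ⟶ Y), ExtremalEpi e ∧ Mono m ∧ e ≫ m = f
  hasLiftingProperty : ∀ {P Q A B : C} (e : P ⟶ Q) (m : A ⟶ B),
    ExtremalEpi e → Mono m → HasLiftingProperty e m

/-- The equivalence classes of monomorphisms to any given object form a `w`-small set. No
smallness of the sets of morphisms is required, in contrast to `WellPowered`. -/
def IsWellpowered (C : Type u) [Category.{v} C] : Prop :=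
  ∀ X : C, Small.{w} (Subobject X)

/-- Tensoring with an object, on either side, preserves monomorphisms. -/
def TensorPreservesMono (C : Type u) [Category.{v} C] [MonoidalCategory C] : Prop :=
  ∀ {X Y : C} (f : X ⟶ Y), Mono f → ∀ M : C, Mono (f ▷ M) ∧ Mono (M ◁ f)

/-- The forgetful functor from Hopf monoids to bimonoids: it forgets the antipode. -/
def hopfForgetToBimon (C : Type u) [Category.{v} C] [MonoidalCategory C] [BraidedCategory C] :
    Hopf C ⥤ Bimon C :=
  inducedFunctor Hopf.toBimon

end CategoryTheory

/-! An antipode S turns a bimonoid morphism f : H ⟶ B into the sequence f, S ≫ f, S ≫ S ≫ f, …,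
whose terms are successive convolution inverses once the multiplication of B is twisted by one more
braiding per step; the braiding need not be symmetric, so these twists need not cancel in pairs.
Such inverse sequences make sense on any comonoid X and are determined by their initial term.

A universal one, t on T, exists: the cofree comonoid on the countable power of B classifies all
sequences, and T is the largest subcomonoid on which the defining equations hold. Products of
inverse sequences are inverse sequences, so T is a bimonoid; dropping the initial term gives an
inverse sequence on the coopposite of T, hence an endomorphism `shift` of T.

The antipode identities for `shift` are visible only after composing with t 0. Their convolution
products are not known to be comonoid morphisms, so universality cannot remove t 0. Hence the
construction is repeated with T in place of B. Inverse sequences in T are forced to be f 0 followed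
by the iterates of `shift`, so the new universal source E is a subcomonoid of T; its inclusion can
be cancelled, and E is the cofree Hopf monoid. -/

namespace CategoryTheory

open scoped CategoryTheory.MonObj CategoryTheory.ComonObj

/-! ### Convolution inverses and braided opposites -/

section Convolution

variable {C : Type u} [Category.{v} C] [MonoidalCategory C]

/-- `f` and `g` are mutually inverse in the convolution monoid of morphisms `X ⟶ A`. -/
def IsConvInverse {X A : C} [ComonObj X] [MonObj A] (f g : X ⟶ A) : Prop :=
  Δ ≫ (f ⊗ₘ g) ≫ μ = ε ≫ η ∧ Δ ≫ (g ⊗ₘ f) ≫ μ = ε ≫ η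

lemma convMul_left_inv_eq_right_inv {X A : C} [ComonObj X] [MonObj A] {f g h : X ⟶ A}
    (hg : Δ ≫ (g ⊗ₘ f) ≫ μ = ε ≫ η) (hh : Δ ≫ (f ⊗ₘ h) ≫ μ = ε ≫ η) : g = h := by
  refine left_inv_eq_right_inv (M := Conv X A) (a := f) ?_ ?_
  · rw [tensorHom_def_assoc] at hg
    exact hg
  · rw [tensorHom_def_assoc] at hh
    exact hh

namespace IsConvInverse

lemma unique {X A : C} [ComonObj X] [MonObj A] {f g h : X ⟶ A}
    (hg : IsConvInverse f g) (hh : IsConvInverse f h) : g = h :=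
  convMul_left_inv_eq_right_inv hg.2 hh.1

lemma precomp {X Y A : C} [ComonObj X] [ComonObj Y] [MonObj A] {f g : X ⟶ A}
    (h : IsConvInverse f g) (k : Y ⟶ X) [IsComonHom k] : IsConvInverse (k ≫ f) (k ≫ g) := by
  refine ⟨?_, ?_⟩
  · rw [← tensorHom_comp_tensorHom, Category.assoc, ← IsComonHom.hom_comul_assoc, h.1,
      IsComonHom.hom_counit_assoc]
  · rw [← tensorHom_comp_tensorHom, Category.assoc, ← IsComonHom.hom_comul_assoc, h.2,
      IsComonHom.hom_counit_assoc]

lemma postcomp {X A B : C} [ComonObj X] [MonObj A] [MonObj B] {f g : X ⟶ A}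
    (h : IsConvInverse f g) (k : A ⟶ B) [IsMonHom k] : IsConvInverse (f ≫ k) (g ≫ k) := by
  refine ⟨?_, ?_⟩
  · rw [← tensorHom_comp_tensorHom, Category.assoc, ← IsMonHom.mul_hom, reassoc_of% h.1,
      IsMonHom.one_hom]
  · rw [← tensorHom_comp_tensorHom, Category.assoc, ← IsMonHom.mul_hom, reassoc_of% h.2,
      IsMonHom.one_hom]

lemma counit_one (X A : C) [ComonObj X] [MonObj A] :
    IsConvInverse (ε[X] ≫ η[A]) (ε[X] ≫ η[A]) := by
  have : Δ ≫ ((ε[X] ≫ η[A]) ⊗ₘ (ε[X] ≫ η[A])) ≫ μ = ε[X] ≫ η[A] := by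
    have := one_mul (1 : Conv X A)
    rw [Conv.mul_eq, Conv.one_eq] at this
    rwa [tensorHom_def_assoc]
  exact ⟨this, this⟩

end IsConvInverse

variable [BraidedCategory C]

lemma braiding_mul_assoc (A : C) [MonObj A] :
    ((β_ A A).hom ≫ μ) ▷ A ≫ (β_ A A).hom ≫ μ =
      (α_ A A A).hom ≫ A ◁ ((β_ A A).hom ≫ μ) ≫ (β_ A A).hom ≫ μ := by
  simp only [comp_whiskerRight, whiskerLeft_comp, Category.assoc,
    BraidedCategory.braiding_naturality_left_assoc,
    BraidedCategory.braiding_naturality_right_assoc]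
  have key : (β_ (A ⊗ A) A).hom ≫ A ◁ (β_ A A).hom =
      (α_ A A A).hom ≫ (β_ A (A ⊗ A)).hom ≫ (β_ A A).hom ▷ A ≫ (α_ A A A).hom := by
    simp [BraidedCategory.braiding_tensor_left_hom, BraidedCategory.braiding_tensor_right_hom,
      BraidedCategory.yang_baxter]
  rw [reassoc_of% key, MonObj.mul_assoc]

lemma comul_braiding_assoc (X : C) [ComonObj X] :
    (Δ ≫ (β_ X X).hom) ≫ X ◁ (Δ ≫ (β_ X X).hom) =
      (Δ ≫ (β_ X X).hom) ≫ ((Δ ≫ (β_ X X).hom) ▷ X) ≫ (α_ X X X).hom := by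
  simp only [comp_whiskerRight, whiskerLeft_comp, Category.assoc,
    ← BraidedCategory.braiding_naturality_left_assoc,
    ← BraidedCategory.braiding_naturality_right_assoc]
  rw [ComonObj.comul_assoc_assoc]
  simp [BraidedCategory.braiding_tensor_left_hom, BraidedCategory.braiding_tensor_right_hom]

/-- The opposite of a monoid, with multiplication `μ` precomposed with the braiding. -/
@[reducible]
def MonObj.braidedOp (A : C) [MonObj A] : MonObj A where
  one := η
  mul := (β_ A A).hom ≫ μ
  one_mul := by simp
  mul_one := by simp
  mul_assoc := braiding_mul_assoc A

/-- The `n`-fold iteration of `MonObj.braidedOp`. -/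
@[reducible]
def MonObj.braidedOpIter (A : C) [i : MonObj A] : ℕ → MonObj A
  | 0 => i
  | n + 1 => @MonObj.braidedOp _ _ _ _ A (MonObj.braidedOpIter A n)

/-- The coopposite of a comonoid, with comultiplication `Δ` postcomposed with the braiding. -/
@[reducible]
def ComonObj.braidedCop (X : C) [ComonObj X] : ComonObj X where
  counit := ε
  comul := Δ ≫ (β_ X X).hom
  counit_comul := by simp [← BraidedCategory.braiding_naturality_right]
  comul_counit := by simp [← BraidedCategory.braiding_naturality_left]
  comul_assoc := comul_braiding_assoc X

/-- Ignoring braidings, both sides send a ⊗ b ⊗ c ⊗ d to a(cd)b: the inner pair can cancel before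
the outer one. -/
lemma tensorμ_mul_braiding_mul (A : C) [MonObj A] :
    tensorμ A A A A ≫ (μ ⊗ₘ ((β_ A A).hom ≫ μ)) ≫ μ =
      (A ⊗ A) ◁ μ ≫ (α_ A A A).hom ≫ A ◁ ((β_ A A).hom ≫ μ) ≫ μ := by
  have key : (α_ A A A).inv ≫ (β_ A A).hom ▷ A ≫ (α_ A A A).hom ≫ A ◁ ((β_ A A).hom ≫ μ) ≫ μ =
      A ◁ μ ≫ (β_ A A).hom ≫ μ := by
    rw [BraidedCategory.braiding_naturality_right_assoc, MonObj.mul_assoc,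
      BraidedCategory.braiding_tensor_right_hom]
    simp
  rw [tensorHom_def'_assoc, MonObj.mul_assoc, associator_naturality_right_assoc,
    tensorμ, ← whiskerLeft_comp_assoc]
  simpa only [whiskerLeft_comp, Category.assoc, Iso.inv_hom_id_assoc,
    associator_naturality_right_assoc] using
    congrArg (fun x ↦ (α_ A A (A ⊗ A)).hom ≫ A ◁ x ≫ μ) key

lemma tensorμ_braiding_mul_mul (A : C) [MonObj A] :
    tensorμ A A A A ≫ (((β_ A A).hom ≫ μ) ⊗ₘ μ) ≫ μ =
      μ ▷ (A ⊗ A) ≫ (α_ A A A).inv ≫ ((β_ A A).hom ≫ μ) ▷ A ≫ μ := by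
  have key : (α_ A A A).hom ≫ A ◁ (β_ A A).hom ≫ (α_ A A A).inv ≫ ((β_ A A).hom ≫ μ) ▷ A ≫ μ =
      μ ▷ A ≫ (β_ A A).hom ≫ μ := by
    rw [BraidedCategory.braiding_naturality_left_assoc, MonObj.mul_assoc_flip,
      BraidedCategory.braiding_tensor_left_hom]
    simp
  have h : tensorμ A A A A = (α_ (A ⊗ A) A A).inv ≫ (α_ A A A).hom ▷ A ≫
      (A ◁ (β_ A A).hom) ▷ A ≫ (α_ A A A).inv ▷ A ≫ (α_ (A ⊗ A) A A).hom := by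
    rw [tensorμ]
    monoidal
  rw [tensorHom_def_assoc, MonObj.mul_assoc_flip, associator_inv_naturality_left_assoc, h]
  simpa only [comp_whiskerRight, Category.assoc, Iso.hom_inv_id_assoc,
    associator_inv_naturality_left_assoc] using
    congrArg (fun x ↦ (α_ (A ⊗ A) A A).inv ≫ x ▷ A ≫ μ) key

/-- Ignoring braidings, both sides are x₁ ⊗ x₄ ⊗ x₂ ⊗ x₃, so the adjacent x₂, x₃ can be contracted
first. -/
lemma comul_comul_braiding_tensorμ (X : C) [ComonObj X] :
    Δ ≫ (Δ ⊗ₘ (Δ ≫ (β_ X X).hom)) ≫ tensorμ X X X X =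
      Δ ≫ X ◁ (Δ ≫ (β_ X X).hom) ≫ (α_ X X X).inv ≫ (X ⊗ X) ◁ Δ := by
  have key : (Δ[X] ≫ (β_ X X).hom) ≫ X ◁ Δ =
      Δ ≫ X ◁ (Δ ≫ (β_ X X).hom) ≫ (α_ X X X).inv ≫ (β_ X X).hom ▷ X ≫ (α_ X X X).hom := by
    rw [Category.assoc, ← BraidedCategory.braiding_naturality_left,
      BraidedCategory.braiding_tensor_left_hom, ComonObj.comul_assoc_flip_assoc]
    simp
  rw [← associator_inv_naturality_right, ← whiskerLeft_comp_assoc, key]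
  rw [tensorHom_def_assoc, ComonObj.comul_assoc_flip_assoc, tensorμ]
  simp only [whiskerLeft_comp, Category.assoc, Iso.inv_hom_id_assoc,
    associator_naturality_right_assoc]

end Convolution

/-! ### Inverse sequences -/

section InverseSequence

variable {C : Type u} [Category.{v} C] [MonoidalCategory C] [BraidedCategory C]

attribute [local instance] ComonObj.instTensorUnit

/-- The inverse of a product is the reversed product of the inverses. The reversal is the reason for
one more braiding per step in `IsInverseSeq`. -/
lemma IsConvInverse.tensor {X Y A : C} [ComonObj X] [ComonObj Y] [MonObj A] {f g : X ⟶ A}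
    {f' g' : Y ⟶ A} (h : IsConvInverse f g) (h' : IsConvInverse f' g') :
    IsConvInverse ((f ⊗ₘ f') ≫ μ) ((g ⊗ₘ g') ≫ (β_ A A).hom ≫ μ) := by
  constructor
  · have e₁ : ((f ⊗ₘ f') ≫ μ) ⊗ₘ ((g ⊗ₘ g') ≫ (β_ A A).hom ≫ μ) =
        ((f ⊗ₘ f') ⊗ₘ (g ⊗ₘ g')) ≫ (μ ⊗ₘ ((β_ A A).hom ≫ μ)) := by
      rw [tensorHom_comp_tensorHom]
    rw [e₁, Comon.tensorObj_comul, Category.assoc, Category.assoc, ← tensorμ_natural_assoc,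
      tensorμ_mul_braiding_mul, tensorHom_comp_tensorHom_assoc, tensorHom_def_assoc,
      ← whiskerLeft_comp_assoc, Category.assoc, h'.1]
    have e₂ : (A ⊗ A) ◁ η ≫ (α_ A A A).hom ≫ A ◁ ((β_ A A).hom ≫ μ) = (ρ_ (A ⊗ A)).hom := by
      rw [associator_naturality_right_assoc, ← whiskerLeft_comp,
        BraidedCategory.braiding_naturality_right_assoc, MonObj.one_mul]
      simp
    rw [whiskerLeft_comp_assoc, reassoc_of% e₂, ← whisker_exchange_assoc,
      rightUnitor_naturality_assoc, Category.assoc, h.1, Comon.tensorObj_counit, tensorHom_def']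
    simp [unitors_equal]
  · have e₁ : ((g ⊗ₘ g') ≫ (β_ A A).hom ≫ μ) ⊗ₘ ((f ⊗ₘ f') ≫ μ) =
        ((g ⊗ₘ g') ⊗ₘ (f ⊗ₘ f')) ≫ (((β_ A A).hom ≫ μ) ⊗ₘ μ) := by
      rw [tensorHom_comp_tensorHom]
    rw [e₁, Comon.tensorObj_comul, Category.assoc, Category.assoc, ← tensorμ_natural_assoc,
      tensorμ_braiding_mul_mul, tensorHom_comp_tensorHom_assoc, tensorHom_def'_assoc,
      ← comp_whiskerRight_assoc, Category.assoc, h.2]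
    have e₂ : η ▷ (A ⊗ A) ≫ (α_ A A A).inv ≫ ((β_ A A).hom ≫ μ) ▷ A = (λ_ (A ⊗ A)).hom := by
      rw [associator_inv_naturality_left_assoc, ← comp_whiskerRight,
        BraidedCategory.braiding_naturality_left_assoc, MonObj.mul_one]
      simp
    rw [comp_whiskerRight_assoc, reassoc_of% e₂, whisker_exchange_assoc,
      leftUnitor_naturality_assoc, Category.assoc, h'.2, Comon.tensorObj_counit,
      MonoidalCategory.tensorHom_def]
    simp

/-- The two sides are a left and a right convolution inverse of f ≫ Δ: the left one because Δ is a
monoid morphism, the right one by cancelling from the inside out. -/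
lemma IsConvInverse.comul {X B : C} [ComonObj X] [BimonObj B] {f g : X ⟶ B} [IsComonHom f]
    (h : IsConvInverse f g) : g ≫ Δ = Δ ≫ (β_ X X).hom ≫ (g ⊗ₘ g) := by
  have : IsMonHom Δ[B] := ⟨by simp, by simp [MonObj.tensorObj.mul_def]⟩
  refine convMul_left_inv_eq_right_inv (h.postcomp Δ[B]).2 ?_
  have e₁ : (f ≫ Δ[B]) ⊗ₘ (Δ ≫ (β_ X X).hom ≫ (g ⊗ₘ g)) =
      (Δ ⊗ₘ (Δ ≫ (β_ X X).hom)) ≫ ((f ⊗ₘ f) ⊗ₘ (g ⊗ₘ g)) := by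
    rw [tensorHom_comp_tensorHom, IsComonHom.hom_comul, Category.assoc]
  rw [e₁, MonObj.tensorObj.mul_def, MonObj.tensorObj.one_def, Category.assoc, tensorμ_natural_assoc,
    reassoc_of% (comul_comul_braiding_tensorμ X), tensorHom_comp_tensorHom, ← id_tensorHom (X ⊗ X),
    tensorHom_comp_tensorHom, h.1]
  have e₂ : (𝟙 (X ⊗ X) ≫ (f ⊗ₘ g) ≫ μ) ⊗ₘ (ε[X] ≫ η[B]) =
      (X ⊗ X) ◁ ε ≫ (ρ_ _).hom ≫ (f ⊗ₘ g) ≫ μ ≫ (ρ_ _).inv ≫ B ◁ η := by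
    rw [Category.id_comp, tensorHom_def', whiskerLeft_comp, Category.assoc, whisker_exchange,
      ← Category.assoc (f ⊗ₘ g), ← rightUnitor_naturality_assoc, Iso.hom_inv_id_assoc]
  have e₃ : Δ ≫ X ◁ (Δ ≫ (β_ X X).hom) ≫ (α_ X X X).inv ≫ (X ⊗ X) ◁ ε ≫ (ρ_ _).hom = Δ[X] := by
    have e₄ : (Δ[X] ≫ (β_ X X).hom) ≫ X ◁ ε = (ρ_ X).inv := (ComonObj.braidedCop X).comul_counit
    rw [← associator_inv_naturality_right_assoc, ← whiskerLeft_comp_assoc, e₄]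
    simp
  rw [e₂, reassoc_of% e₃, reassoc_of% h.1, MonoidalCategory.tensorHom_def,
    unitors_inv_equal, rightUnitor_inv_naturality_assoc]

lemma IsConvInverse.counit {X B : C} [ComonObj X] [BimonObj B] {f g : X ⟶ B} [IsComonHom f]
    (h : IsConvInverse f g) : g ≫ ε = ε := by
  have : IsMonHom ε[B] := ⟨by simp, by simp⟩
  have h₁ := h.postcomp ε[B]
  rw [IsComonHom.hom_counit] at h₁
  have h₂ := IsConvInverse.counit_one X (𝟙_ C)
  have h₃ : ε[X] ≫ η[𝟙_ C] = ε := by simp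
  rw [h₃] at h₂
  exact h₁.unique h₂

lemma isComonHom_tensorHom {X X' Y Y' : C} [ComonObj X] [ComonObj X'] [ComonObj Y] [ComonObj Y']
    (f : X ⟶ X') (g : Y ⟶ Y') [IsComonHom f] [IsComonHom g] : IsComonHom (f ⊗ₘ g) := by
  let F : Comon.mk X ⟶ Comon.mk X' := Comon.Hom.mk f
  let G : Comon.mk Y ⟶ Comon.mk Y' := Comon.Hom.mk g
  have h := (F ⊗ₘ G).isComonHom_hom
  rw [Comon.monoidal_tensorHom_hom] at h
  exact h

lemma isComonHom_whiskerRight {X X' : C} [ComonObj X] [ComonObj X'] (f : X ⟶ X') [IsComonHom f]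
    (Y : C) [ComonObj Y] : IsComonHom (f ▷ Y) := by
  rw [← tensorHom_id]
  exact isComonHom_tensorHom f (𝟙 Y)

lemma isComonHom_whiskerLeft (X : C) [ComonObj X] {Y Y' : C} [ComonObj Y] [ComonObj Y']
    (f : Y ⟶ Y') [IsComonHom f] : IsComonHom (X ◁ f) := by
  rw [← id_tensorHom]
  exact isComonHom_tensorHom (𝟙 X) f

lemma isComonHom_associator_hom (X Y Z : C) [ComonObj X] [ComonObj Y] [ComonObj Z] :
    IsComonHom (α_ X Y Z).hom := by
  have h := (α_ (Comon.mk X) (Comon.mk Y) (Comon.mk Z)).hom.isComonHom_hom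
  rw [Comon.monoidal_associator_hom_hom] at h
  change IsComonHom (𝟙 (X ⊗ Y) ▷ Z ≫ (α_ X Y Z).hom ≫ X ◁ 𝟙 (Y ⊗ Z)) at h
  rwa [id_whiskerRight, whiskerLeft_id, Category.id_comp, Category.comp_id] at h

lemma isComonHom_leftUnitor_hom (X : C) [ComonObj X] : IsComonHom (λ_ X).hom := by
  have h := (λ_ (Comon.mk X)).hom.isComonHom_hom
  rw [Comon.monoidal_leftUnitor_hom_hom] at h
  change IsComonHom (𝟙 (𝟙_ C) ▷ X ≫ (λ_ X).hom) at h
  rwa [id_whiskerRight, Category.id_comp] at h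

lemma isComonHom_rightUnitor_hom (X : C) [ComonObj X] : IsComonHom (ρ_ X).hom := by
  have h := (ρ_ (Comon.mk X)).hom.isComonHom_hom
  rw [Comon.monoidal_rightUnitor_hom_hom] at h
  change IsComonHom (X ◁ 𝟙 (𝟙_ C) ≫ (ρ_ X).hom) at h
  rwa [whiskerLeft_id, Category.id_comp] at h

lemma isComonHom_mul (B : C) [BimonObj B] : IsComonHom μ[B] :=
  ⟨by simp, by simp⟩

lemma isComonHom_one (B : C) [BimonObj B] : IsComonHom η[B] :=
  ⟨by simp, by simp [MonObj.tensorObj.one_def]⟩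

lemma braidedOpIter_one (A : C) [MonObj A] (n : ℕ) : (MonObj.braidedOpIter A n).one = η[A] := by
  induction n with
  | zero => rfl
  | succ n ih => exact ih

/-- A sequence of morphisms from a comonoid to a bimonoid that starts with a comonoid morphism and
in which each term is convolution inverse to the preceding one, with respect to the multiplication
twisted once more by the braiding at each step. -/
structure IsInverseSeq {X B : C} [ComonObj X] [BimonObj B] (f : ℕ → (X ⟶ B)) : Prop where
  isComonHom : IsComonHom (f 0)
  isConvInverse : ∀ n,
    @IsConvInverse _ _ _ X B _ (MonObj.braidedOpIter B n) (f n) (f (n + 1))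

namespace IsInverseSeq

variable {X Y B B' : C} [ComonObj X] [ComonObj Y] [BimonObj B] [BimonObj B']

lemma ext {f g : ℕ → (X ⟶ B)} (hf : IsInverseSeq f) (hg : IsInverseSeq g) (h : f 0 = g 0) :
    f = g := by
  funext n
  induction n with
  | zero => exact h
  | succ n ih =>
    let := MonObj.braidedOpIter B n
    have h₁ := hf.isConvInverse n
    rw [ih] at h₁
    exact h₁.unique (hg.isConvInverse n)

lemma precomp {f : ℕ → (X ⟶ B)} (hf : IsInverseSeq f) (k : Y ⟶ X) [IsComonHom k] :
    IsInverseSeq fun n ↦ k ≫ f n where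
  isComonHom := have := hf.isComonHom; inferInstance
  isConvInverse n :=
    let := MonObj.braidedOpIter B n
    (hf.isConvInverse n).precomp k

lemma one : IsInverseSeq fun _ ↦ η[B] where
  isComonHom := isComonHom_one B
  isConvInverse n := by
    have h := @IsConvInverse.counit_one _ _ _ (𝟙_ C) B _ (MonObj.braidedOpIter B n)
    have h₁ : ε[𝟙_ C] ≫ (MonObj.braidedOpIter B n).one = η[B] := by
      rw [braidedOpIter_one]
      exact Category.id_comp _
    rwa [h₁] at h

lemma tensor {f : ℕ → (X ⟶ B)} {g : ℕ → (Y ⟶ B)} (hf : IsInverseSeq f) (hg : IsInverseSeq g) :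
    IsInverseSeq fun n ↦ (f n ⊗ₘ g n) ≫ (MonObj.braidedOpIter B n).mul where
  isComonHom :=
    have := hf.isComonHom
    have := hg.isComonHom
    have := isComonHom_tensorHom (f 0) (g 0)
    have := isComonHom_mul B
    inferInstanceAs (IsComonHom ((f 0 ⊗ₘ g 0) ≫ μ[B]))
  isConvInverse n :=
    let := MonObj.braidedOpIter B n
    (hf.isConvInverse n).tensor (hg.isConvInverse n)

/-- Naturality moves the extra braiding from the multiplication of B to the comultiplication of X,
exchanging the two inverse equations. -/
lemma shift {f : ℕ → (X ⟶ B)} (hf : IsInverseSeq f) :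
    @IsInverseSeq _ _ _ _ X B (ComonObj.braidedCop X) _ fun n ↦ f (n + 1) := by
  refine @IsInverseSeq.mk _ _ _ _ X B (ComonObj.braidedCop X) _ _ ?_ fun n ↦ ?_
  · have := hf.isComonHom
    have h : IsConvInverse (f 0) (f 1) := hf.isConvInverse 0
    exact @IsComonHom.mk _ _ _ X B (ComonObj.braidedCop X) _ _ h.counit
      (h.comul.trans (Category.assoc _ _ _).symm)
  · let := MonObj.braidedOpIter B n
    have h := hf.isConvInverse (n + 1)
    have h₁ : Δ[X] ≫ (f (n + 1) ⊗ₘ f (n + 2)) ≫ (β_ B B).hom ≫ μ = ε ≫ η := h.1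
    have h₂ : Δ[X] ≫ (f (n + 2) ⊗ₘ f (n + 1)) ≫ (β_ B B).hom ≫ μ = ε ≫ η := h.2
    rw [BraidedCategory.braiding_naturality_assoc, ← Category.assoc] at h₁ h₂
    exact ⟨h₂, h₁⟩

end IsInverseSeq

lemma isComonHom_braidedCop {X Y : C} [ComonObj X] [ComonObj Y] (f : X ⟶ Y) [IsComonHom f] :
    @IsComonHom _ _ _ X Y (ComonObj.braidedCop X) (ComonObj.braidedCop Y) f :=
  @IsComonHom.mk _ _ _ X Y (ComonObj.braidedCop X) (ComonObj.braidedCop Y) f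
    (IsComonHom.hom_counit f) (by
      change f ≫ Δ ≫ (β_ Y Y).hom = (Δ ≫ (β_ X X).hom) ≫ (f ⊗ₘ f)
      simp)

/-- The sequence `f, S ≫ f, S ≫ S ≫ f, …` for a bimonoid morphism `f` out of a Hopf monoid. -/
def antipodeSeq {H B : C} [HopfObj H] (f : H ⟶ B) : ℕ → (H ⟶ B)
  | 0 => f
  | n + 1 => HopfObj.antipode ≫ antipodeSeq f n

/-- The antipode reverses the comultiplication, which matches the new twist of the multiplication;
the two inverse equations alternate. -/
lemma isInverseSeq_antipodeSeq {H B : C} [HopfObj H] [BimonObj B] (f : H ⟶ B) [IsBimonHom f] :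
    IsInverseSeq (antipodeSeq f) where
  isComonHom := inferInstanceAs (IsComonHom f)
  isConvInverse n := by
    induction n with
    | zero =>
      have h : IsConvInverse (𝟙 H) (HopfObj.antipode (X := H)) := ⟨by simp, by simp⟩
      have h' := h.postcomp f
      rw [Category.id_comp] at h'
      exact h'
    | succ n ih =>
      let := MonObj.braidedOpIter B n
      have key (g h : H ⟶ B) :
          Δ ≫ ((HopfObj.antipode ≫ g) ⊗ₘ (HopfObj.antipode ≫ h)) ≫ (β_ B B).hom ≫ μ =
          HopfObj.antipode ≫ Δ ≫ (h ⊗ₘ g) ≫ μ := by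
        rw [BraidedCategory.braiding_naturality_assoc, ← tensorHom_comp_tensorHom, Category.assoc,
          ← Category.assoc HopfObj.antipode, HopfObj.antipode_comul]
        simp only [Category.assoc]
      refine ⟨(key _ _).trans ?_, (key _ _).trans ?_⟩
      · rw [ih.2]
        exact HopfObj.antipode_counit_assoc _ _
      · rw [ih.1]
        exact HopfObj.antipode_counit_assoc _ _

end InverseSequence

/-! ### Bimonoid structure and shift on a universal source -/

section UniversalInverseSequence

variable {C : Type u} [Category.{v} C] [MonoidalCategory C] [BraidedCategory C]

attribute [local instance] ComonObj.instTensorUnit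

/-- An inverse sequence `t : ℕ → (T ⟶ B)` through whose initial term the initial term of every
inverse sequence factors by a unique comonoid morphism. -/
structure IsUniversalInverseSeq {T B : C} [ComonObj T] [BimonObj B] (t : ℕ → (T ⟶ B)) : Prop where
  isInverseSeq : IsInverseSeq t
  exists_lift : ∀ {X : C} [ComonObj X] (f : ℕ → (X ⟶ B)), IsInverseSeq f →
    ∃ h : X ⟶ T, IsComonHom h ∧ h ≫ t 0 = f 0
  hom_ext : ∀ {X : C} [ComonObj X] (h h' : X ⟶ T), IsComonHom h → IsComonHom h' →
    h ≫ t 0 = h' ≫ t 0 → h = h'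

namespace IsUniversalInverseSeq

section

variable {T B : C} [ComonObj T] [BimonObj B] {t : ℕ → (T ⟶ B)} (ht : IsUniversalInverseSeq t)

/-- The comonoid morphism induced by an inverse sequence. -/
noncomputable def lift {X : C} [ComonObj X] {f : ℕ → (X ⟶ B)} (hf : IsInverseSeq f) : X ⟶ T :=
  (ht.exists_lift f hf).choose

lemma isComonHom_lift {X : C} [ComonObj X] {f : ℕ → (X ⟶ B)} (hf : IsInverseSeq f) :
    IsComonHom (ht.lift hf) :=
  (ht.exists_lift f hf).choose_spec.1

lemma lift_zero {X : C} [ComonObj X] {f : ℕ → (X ⟶ B)} (hf : IsInverseSeq f) :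
    ht.lift hf ≫ t 0 = f 0 :=
  (ht.exists_lift f hf).choose_spec.2

lemma lift_app {X : C} [ComonObj X] {f : ℕ → (X ⟶ B)} (hf : IsInverseSeq f) (n : ℕ) :
    ht.lift hf ≫ t n = f n :=
  have := ht.isComonHom_lift hf
  congrFun ((ht.isInverseSeq.precomp (ht.lift hf)).ext hf (ht.lift_zero hf)) n

/-- The unit of the source of a universal inverse sequence. -/
noncomputable def one : 𝟙_ C ⟶ T := ht.lift IsInverseSeq.one

/-- The multiplication of the source of a universal inverse sequence. -/
noncomputable def mul : T ⊗ T ⟶ T := ht.lift (ht.isInverseSeq.tensor ht.isInverseSeq)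

lemma one_zero : ht.one ≫ t 0 = η := ht.lift_zero _

lemma mul_zero : ht.mul ≫ t 0 = (t 0 ⊗ₘ t 0) ≫ μ := ht.lift_zero _

lemma isComonHom_one : IsComonHom ht.one := ht.isComonHom_lift _

lemma isComonHom_mul : IsComonHom ht.mul := ht.isComonHom_lift _

/-- The source of a universal inverse sequence is a bimonoid. -/
@[reducible]
noncomputable def bimonObj : BimonObj T where
  one := ht.one
  mul := ht.mul
  one_mul := by
    have := ht.isComonHom_one
    have := ht.isComonHom_mul
    have := isComonHom_whiskerRight ht.one T
    refine ht.hom_ext _ _ inferInstance (isComonHom_leftUnitor_hom T) ?_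
    rw [Category.assoc, mul_zero, tensorHom_def_assoc, ← comp_whiskerRight_assoc, one_zero,
      ← whisker_exchange_assoc, MonObj.one_mul, leftUnitor_naturality]
  mul_one := by
    have := ht.isComonHom_one
    have := ht.isComonHom_mul
    have := isComonHom_whiskerLeft T ht.one
    refine ht.hom_ext _ _ inferInstance (isComonHom_rightUnitor_hom T) ?_
    rw [Category.assoc, mul_zero, tensorHom_def'_assoc, ← whiskerLeft_comp_assoc, one_zero,
      whisker_exchange_assoc, MonObj.mul_one, rightUnitor_naturality]
  mul_assoc := by
    have := ht.isComonHom_mul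
    have := isComonHom_whiskerLeft T ht.mul
    have := isComonHom_whiskerRight ht.mul T
    have := isComonHom_associator_hom T T T
    refine ht.hom_ext _ _ inferInstance inferInstance ?_
    simp only [Category.assoc, mul_zero]
    rw [← tensorHom_id, ← id_tensorHom, tensorHom_comp_tensorHom_assoc,
      tensorHom_comp_tensorHom_assoc, mul_zero, Category.id_comp]
    have e₁ : ((t 0 ⊗ₘ t 0) ≫ μ) ⊗ₘ t 0 = ((t 0 ⊗ₘ t 0) ⊗ₘ t 0) ≫ μ ▷ B := by
      rw [← tensorHom_id, tensorHom_comp_tensorHom, Category.comp_id]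
    have e₂ : t 0 ⊗ₘ ((t 0 ⊗ₘ t 0) ≫ μ) = (t 0 ⊗ₘ (t 0 ⊗ₘ t 0)) ≫ B ◁ μ := by
      rw [← id_tensorHom, tensorHom_comp_tensorHom, Category.comp_id]
    rw [e₁, e₂, Category.assoc, Category.assoc, MonObj.mul_assoc, associator_naturality_assoc]
  mul_comul := by
    have h := ht.isComonHom_mul.hom_comul
    rwa [Comon.tensorObj_comul, Category.assoc] at h
  one_comul := ht.isComonHom_one.hom_comul
  mul_counit := ht.isComonHom_mul.hom_counit
  one_counit := ht.isComonHom_one.hom_counit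

lemma isBimonHom_zero : letI := ht.bimonObj; IsBimonHom (t 0) :=
  letI := ht.bimonObj
  { one_hom := ht.one_zero
    mul_hom := ht.mul_zero
    hom_counit := ht.isInverseSeq.isComonHom.hom_counit
    hom_comul := ht.isInverseSeq.isComonHom.hom_comul }

/-- The endomorphism shifting a universal inverse sequence by one. -/
noncomputable def shift : T ⟶ T :=
  @lift _ _ _ _ T B _ _ t ht T (ComonObj.braidedCop T) _ ht.isInverseSeq.shift

lemma shift_app (n : ℕ) : ht.shift ≫ t n = t (n + 1) :=
  @lift_app _ _ _ _ T B _ _ t ht T (ComonObj.braidedCop T) _ ht.isInverseSeq.shift n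

lemma isComonHom_shift : @IsComonHom _ _ _ T T (ComonObj.braidedCop T) _ ht.shift :=
  @isComonHom_lift _ _ _ _ T B _ _ t ht T (ComonObj.braidedCop T) _ ht.isInverseSeq.shift

/-- A bimonoid morphism from a Hopf monoid to the target of a universal inverse sequence factors
through its source. -/
lemma exists_isBimonHom {H : C} [HopfObj H] (f : H ⟶ B) [IsBimonHom f] :
    letI := ht.bimonObj; ∃ h : H ⟶ T, IsBimonHom h ∧ h ≫ t 0 = f := by
  let := ht.bimonObj
  let h := ht.lift (isInverseSeq_antipodeSeq f)
  have hh : h ≫ t 0 = f := ht.lift_zero _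
  have hc : IsComonHom h := ht.isComonHom_lift _
  -- In both monoid equations the two sides are comonoid morphisms to T, so they may be compared
  -- after t 0.
  refine ⟨h, @IsBimonHom.mk _ _ _ _ _ _ _ _ h ⟨?_, ?_⟩ hc, hh⟩
  · have := CategoryTheory.isComonHom_one H
    refine ht.hom_ext _ _ inferInstance ht.isComonHom_one ?_
    rw [Category.assoc, hh, IsMonHom.one_hom]
    exact ht.one_zero.symm
  · have := CategoryTheory.isComonHom_mul H
    have := ht.isComonHom_mul
    have := isComonHom_tensorHom h h
    refine ht.hom_ext _ _ inferInstance
      (inferInstanceAs (IsComonHom ((h ⊗ₘ h) ≫ ht.mul))) ?_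
    change _ = ((h ⊗ₘ h) ≫ ht.mul) ≫ t 0
    rw [Category.assoc, hh, IsMonHom.mul_hom, Category.assoc, mul_zero,
      tensorHom_comp_tensorHom_assoc, hh]

end

section

variable {T B : C} [BimonObj T] [BimonObj B] {t : ℕ → (T ⟶ B)} (ht : IsUniversalInverseSeq t)
  [IsBimonHom (t 0)]

/-- Both f 1 and f 0 ≫ `shift` are comonoid morphisms from the coopposite of X, and after t 0 both
are inverse to f 0 ≫ t 0. The comonoid structure varies in the induction because each shift passes
to the coopposite. -/
lemma isInverseSeq_succ {X : C} [i : ComonObj X] {f : ℕ → (X ⟶ T)} (hf : IsInverseSeq f) (n : ℕ) :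
    f (n + 1) = f n ≫ ht.shift := by
  induction n generalizing i f with
  | zero =>
    have := hf.isComonHom
    have h₀ := isComonHom_braidedCop (f 0)
    have h₁ : IsConvInverse (f 0 ≫ t 0) (f 0 ≫ t 1) :=
      IsConvInverse.precomp (ht.isInverseSeq.isConvInverse 0) (f 0)
    have h₂ : IsConvInverse (f 0 ≫ t 0) (f 1 ≫ t 0) :=
      IsConvInverse.postcomp (hf.isConvInverse 0) (t 0)
    have h₃ := @IsInverseSeq.isComonHom _ _ _ _ X T (ComonObj.braidedCop X) _ _ hf.shift
    refine @hom_ext _ _ _ _ _ _ _ _ _ ht X (ComonObj.braidedCop X) _ _ h₃ ?_ ?_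
    · exact @instIsComonHomComp _ _ _ X T T (ComonObj.braidedCop X) (ComonObj.braidedCop T) _ _ _
        h₀ ht.isComonHom_shift
    · rw [Category.assoc, ht.shift_app]
      exact h₂.unique h₁
  | succ n ih => exact ih (i := ComonObj.braidedCop X) hf.shift

/-- The iterates of the shift. -/
noncomputable def shiftIter : ℕ → (T ⟶ T)
  | 0 => 𝟙 T
  | n + 1 => shiftIter n ≫ ht.shift

lemma isInverseSeq_eq {X : C} [ComonObj X] {f : ℕ → (X ⟶ T)} (hf : IsInverseSeq f) (n : ℕ) :
    f n = f 0 ≫ ht.shiftIter n := by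
  induction n with
  | zero => exact (Category.comp_id _).symm
  | succ n ih => rw [ht.isInverseSeq_succ hf, ih, Category.assoc, shiftIter]

end

end IsUniversalInverseSeq

/-- A bimonoid carries an antipode as soon as it is the source of a universal inverse sequence
whose initial term is a monomorphism. -/
@[reducible]
noncomputable def IsUniversalInverseSeq.hopfObj {T B : C} [ComonObj T] [BimonObj B]
    {t : ℕ → (T ⟶ B)} (ht : IsUniversalInverseSeq t) [Mono (t 0)] : HopfObj T :=
  letI := ht.bimonObj
  have h : IsConvInverse (t 0) (t 1) := ht.isInverseSeq.isConvInverse 0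
  have := ht.isBimonHom_zero
  { antipode := ht.shift
    antipode_left := by
      rw [← cancel_mono (t 0), Category.assoc, Category.assoc, Category.assoc, IsMonHom.mul_hom,
        IsMonHom.one_hom, ← tensorHom_id, tensorHom_comp_tensorHom_assoc, ht.shift_app,
        Category.id_comp]
      exact h.2
    antipode_right := by
      rw [← cancel_mono (t 0), Category.assoc, Category.assoc, Category.assoc, IsMonHom.mul_hom,
        IsMonHom.one_hom, ← id_tensorHom, tensorHom_comp_tensorHom_assoc, ht.shift_app,
        Category.id_comp]
      exact h.1 }

end UniversalInverseSequence

/-! ### Images and largest equalizing subcomonoids -/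

section Subcomonoid

variable {C : Type u} [Category.{v} C] [MonoidalCategory C]

lemma TensorPreservesMono.mono_tensorHom (h : TensorPreservesMono C) {X X' Y Y' : C} (f : X ⟶ X')
    (g : Y ⟶ Y') [hf : Mono f] [hg : Mono g] : Mono (f ⊗ₘ g) := by
  rw [MonoidalCategory.tensorHom_def]
  have := (h f hf Y).1
  have := (h g hg X').2
  exact mono_comp _ _

/-- A subobject of a comonoid is a comonoid if the comultiplication restricts to it. -/
@[reducible]
def ComonObj.ofMono (h : TensorPreservesMono C) {I K : C} [ComonObj K] (m : I ⟶ K) [Mono m]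
    (δ : I ⟶ I ⊗ I) (hδ : δ ≫ (m ⊗ₘ m) = m ≫ Δ) : ComonObj I where
  counit := m ≫ ε
  comul := δ
  counit_comul := by
    have := (h m inferInstance (𝟙_ C)).2
    rw [← cancel_mono (𝟙_ C ◁ m), Category.assoc, comp_whiskerRight_assoc, ← whisker_exchange,
      ← tensorHom_def_assoc, reassoc_of% hδ, ComonObj.counit_comul, leftUnitor_inv_naturality]
  comul_counit := by
    have := (h m inferInstance (𝟙_ C)).1
    rw [← cancel_mono (m ▷ 𝟙_ C), Category.assoc, whiskerLeft_comp_assoc, whisker_exchange,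
      ← tensorHom_def'_assoc, reassoc_of% hδ, ComonObj.comul_counit, rightUnitor_inv_naturality]
  comul_assoc := by
    have := h.mono_tensorHom m m
    have := h.mono_tensorHom m (m ⊗ₘ m)
    rw [← cancel_mono (m ⊗ₘ m ⊗ₘ m)]
    simp only [Category.assoc]
    rw [← associator_naturality, ← tensorHom_id, ← id_tensorHom, tensorHom_comp_tensorHom,
      tensorHom_comp_tensorHom_assoc, hδ, Category.id_comp]
    have e₁ : m ⊗ₘ (m ≫ Δ) = (m ⊗ₘ m) ≫ K ◁ Δ := by
      rw [← id_tensorHom, tensorHom_comp_tensorHom, Category.comp_id]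
    have e₂ : (m ≫ Δ) ⊗ₘ m = (m ⊗ₘ m) ≫ Δ ▷ K := by
      rw [← tensorHom_id, tensorHom_comp_tensorHom, Category.comp_id]
    rw [e₁, e₂, Category.assoc, reassoc_of% hδ, reassoc_of% hδ, ComonObj.comul_assoc]

lemma IsComonHom.of_comp_mono (hm : TensorPreservesMono C) {X I K : C} [ComonObj X] [ComonObj I]
    [ComonObj K] (h : X ⟶ I) (m : I ⟶ K) [Mono m] [IsComonHom m] [IsComonHom (h ≫ m)] :
    IsComonHom h where
  hom_counit := by
    rw [← IsComonHom.hom_counit m, ← Category.assoc, IsComonHom.hom_counit]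
  hom_comul := by
    have := hm.mono_tensorHom m m
    rw [← cancel_mono (m ⊗ₘ m), Category.assoc, ← IsComonHom.hom_comul, ← Category.assoc,
      IsComonHom.hom_comul, Category.assoc, tensorHom_comp_tensorHom]

/-- The joint image of a small family of comonoid morphisms is a comonoid. -/
lemma exists_comonoid_image (h_colim : HasColimitsOfSize.{w, w} C)
    (h_fact : ExtrEpiMonoStructured C)
    (h_mono : TensorPreservesMono C) {J : Type w} {K : C} [ComonObj K] (X : J → C)
    [∀ i, ComonObj (X i)] (f : ∀ i, X i ⟶ K) [∀ i, IsComonHom (f i)] :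
    ∃ (I : C) (_ : ComonObj I) (m : I ⟶ K), Mono m ∧ IsComonHom m ∧
      (∀ i, ∃ h : X i ⟶ I, h ≫ m = f i) ∧
      ∀ {Z : C} (a b : K ⟶ Z), (∀ i, f i ≫ a = f i ≫ b) → m ≫ a = m ≫ b := by
  obtain ⟨I, e, m, he, hm, hem⟩ := h_fact.exists_factorization (Limits.Sigma.desc f)
  have hf (i : J) : (Limits.Sigma.ι X i ≫ e) ≫ m = f i := by
    rw [Category.assoc, hem, Limits.Sigma.ι_desc]
  have := h_mono.mono_tensorHom m m
  -- The diagonal of this square is the comultiplication of the image.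
  have sq : CommSq
      (Limits.Sigma.desc fun i ↦ Δ ≫ ((Limits.Sigma.ι X i ≫ e) ⊗ₘ (Limits.Sigma.ι X i ≫ e)))
      e (m ⊗ₘ m) (m ≫ Δ) := ⟨by
    refine Limits.Sigma.hom_ext _ _ fun i ↦ ?_
    rw [Limits.Sigma.ι_desc_assoc, Category.assoc, tensorHom_comp_tensorHom, hf, reassoc_of% hem,
      Limits.Sigma.ι_desc_assoc, IsComonHom.hom_comul]⟩
  have := h_fact.hasLiftingProperty e (m ⊗ₘ m) he inferInstance
  refine ⟨I, ComonObj.ofMono h_mono m sq.lift sq.fac_right, m, hm, ?_, fun i ↦ ⟨_, hf i⟩, ?_⟩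
  · exact @IsComonHom.mk _ _ _ _ _ (ComonObj.ofMono h_mono m sq.lift sq.fac_right) _ m rfl
      sq.fac_right.symm
  · intro Z a b hab
    rw [← cancel_epi e, reassoc_of% hem, reassoc_of% hem]
    refine Limits.Sigma.hom_ext _ _ fun i ↦ ?_
    rw [Limits.Sigma.ι_desc_assoc, Limits.Sigma.ι_desc_assoc, hab]

/-- Among the comonoid morphisms to `K` that equalize given pairs of morphisms there is a universal
one, and it is a monomorphism. -/
lemma exists_universal_equalizing_subcomonoid (h_colim : HasColimitsOfSize.{w, w} C)
    (h_fact : ExtrEpiMonoStructured C) (h_wp : IsWellpowered.{w} C) (h_mono : TensorPreservesMono C)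
    {K : C} [ComonObj K] (r : ∀ Z : C, (K ⟶ Z) → (K ⟶ Z) → Prop) :
    ∃ (E : C) (_ : ComonObj E) (i : E ⟶ K), Mono i ∧ IsComonHom i ∧
      (∀ Z (a b : K ⟶ Z), r Z a b → i ≫ a = i ≫ b) ∧
      ∀ {X : C} [ComonObj X] (f : X ⟶ K) [IsComonHom f],
        (∀ Z (a b : K ⟶ Z), r Z a b → f ≫ a = f ≫ b) → ∃ h : X ⟶ E, h ≫ i = f := by
  let S : Set (Subobject K) := {s | ∃ (I : C) (_ : ComonObj I) (m : I ⟶ K) (_ : Mono m),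
    Subobject.mk m = s ∧ IsComonHom m ∧ ∀ Z (a b : K ⟶ Z), r Z a b → m ≫ a = m ≫ b}
  have := h_wp K
  have hS (s : S) := s.2
  choose I hI m hm hms hmc hmr using hS
  let σ := equivShrink.{w} S
  obtain ⟨E, hE, i, hi, hic, hfac, huniv⟩ := exists_comonoid_image h_colim h_fact h_mono
    (fun j ↦ I (σ.symm j)) (fun j ↦ m (σ.symm j))
  refine ⟨E, hE, i, hi, hic, fun Z a b hab ↦ huniv a b fun j ↦ hmr _ Z a b hab, ?_⟩
  intro X _ f _ hf
  -- The image of f is itself an equalizing subcomonoid, so it lies in the joint image E of all of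
  -- them.
  obtain ⟨J, hJ, n, hn, hnc, hnf, hnu⟩ := exists_comonoid_image h_colim h_fact h_mono
    (fun _ : PUnit.{w + 1} ↦ X) (fun _ ↦ f)
  obtain ⟨g, hg⟩ := hnf PUnit.unit
  let s : S := ⟨Subobject.mk n, J, hJ, n, hn, rfl, hnc,
    fun Z a b hab ↦ hnu a b fun _ ↦ hf Z a b hab⟩
  obtain ⟨k, hk⟩ := hfac (σ s)
  have hs : Subobject.mk n ≤ Subobject.mk (m (σ.symm (σ s))) := by
    rw [hms, σ.symm_apply_apply]
  refine ⟨g ≫ Subobject.ofMkLEMk _ _ hs ≫ k, ?_⟩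
  rw [Category.assoc, Category.assoc, hk, Subobject.ofMkLEMk_comp, hg]

end Subcomonoid

/-! ### Existence of universal inverse sequences and cofree Hopf monoids -/

section Universal

variable {C : Type u} [Category.{v} C] [MonoidalCategory C] [BraidedCategory C]

/-- The equations that make a sequence of morphisms from a comonoid to a bimonoid an inverse
sequence. -/
inductive InverseSeqRel {K B : C} [ComonObj K] [BimonObj B] (p : ℕ → (K ⟶ B)) :
    ∀ Z : C, (K ⟶ Z) → (K ⟶ Z) → Prop
  | counit : InverseSeqRel p _ (p 0 ≫ ε) ε
  | comul : InverseSeqRel p _ (p 0 ≫ Δ) (Δ ≫ (p 0 ⊗ₘ p 0))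
  | left (n : ℕ) : InverseSeqRel p _ (Δ ≫ (p n ⊗ₘ p (n + 1)) ≫ (MonObj.braidedOpIter B n).mul)
      (ε ≫ (MonObj.braidedOpIter B n).one)
  | right (n : ℕ) : InverseSeqRel p _ (Δ ≫ (p (n + 1) ⊗ₘ p n) ≫ (MonObj.braidedOpIter B n).mul)
      (ε ≫ (MonObj.braidedOpIter B n).one)

/-- Turns the inverse sequence conditions into equalizing pairs of morphisms out of K, the input of
the subcomonoid construction. -/
lemma isInverseSeq_comp_iff {X K B : C} [ComonObj X] [ComonObj K] [BimonObj B] (p : ℕ → (K ⟶ B))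
    (f : X ⟶ K) [IsComonHom f] :
    IsInverseSeq (fun n ↦ f ≫ p n) ↔
      ∀ Z (a b : K ⟶ Z), InverseSeqRel p Z a b → f ≫ a = f ≫ b := by
  have key (x y : K ⟶ B) (M : B ⊗ B ⟶ B) :
      Δ ≫ ((f ≫ x) ⊗ₘ (f ≫ y)) ≫ M = f ≫ Δ ≫ (x ⊗ₘ y) ≫ M := by
    rw [← tensorHom_comp_tensorHom, Category.assoc, ← IsComonHom.hom_comul_assoc]
  have key' (M : 𝟙_ C ⟶ B) : ε ≫ M = f ≫ ε ≫ M := (IsComonHom.hom_counit_assoc f M).symm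
  constructor
  · rintro ⟨⟨h₁, h₂⟩, h⟩ Z a b (_ | _ | n | n)
    · rw [← Category.assoc, h₁, IsComonHom.hom_counit]
    · rw [← Category.assoc, h₂, ← tensorHom_comp_tensorHom, IsComonHom.hom_comul_assoc]
    · exact (key _ _ _).symm.trans ((h n).1.trans (key' _))
    · exact (key _ _ _).symm.trans ((h n).2.trans (key' _))
  · intro h
    refine ⟨⟨?_, ?_⟩, fun n ↦ ⟨?_, ?_⟩⟩
    · rw [Category.assoc, h _ _ _ .counit, IsComonHom.hom_counit]
    · rw [Category.assoc, h _ _ _ .comul, ← tensorHom_comp_tensorHom, IsComonHom.hom_comul_assoc]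
    · exact (key _ _ _).trans ((h _ _ _ (.left n)).trans (key' _).symm)
    · exact (key _ _ _).trans ((h _ _ _ (.right n)).trans (key' _).symm)

lemma exists_isUniversalInverseSeq [HasCountableProducts C]
    (h_colim : HasColimitsOfSize.{w, w} C) (h_fact : ExtrEpiMonoStructured C)
    (h_wp : IsWellpowered.{w} C) (h_mono : TensorPreservesMono C)
    (h_cofree : (Comon.forget C).IsLeftAdjoint) (B : C) [BimonObj B] :
    ∃ (T : C) (_ : ComonObj T) (t : ℕ → (T ⟶ B)), IsUniversalInverseSeq t := by
  let adj := Adjunction.ofIsLeftAdjoint (Comon.forget C)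
  let P : C := ∏ᶜ fun _ : ℕ ↦ B
  let K : Comon C := (Comon.forget C).rightAdjoint.obj P
  let c : K.X ⟶ P := adj.counit.app P
  let p (n : ℕ) : K.X ⟶ B := c ≫ Pi.π (fun _ : ℕ ↦ B) n
  have hp {X : C} [ComonObj X] (f : ℕ → (X ⟶ B)) : ∃ g : X ⟶ K.X, IsComonHom g ∧
      ∀ n, g ≫ p n = f n := by
    let g : Comon.mk X ⟶ K := adj.homEquiv (Comon.mk X) P (Pi.lift f)
    refine ⟨g.hom, inferInstance, fun n ↦ ?_⟩
    have hg : g.hom ≫ c = Pi.lift f :=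
      (adj.homEquiv_counit (X := Comon.mk X) (g := g)).symm.trans (Equiv.symm_apply_apply _ _)
    rw [reassoc_of% hg, Pi.lift_π]
  have hp' {X : C} [ComonObj X] (g g' : X ⟶ K.X) (hg : IsComonHom g) (hg' : IsComonHom g')
      (h : ∀ n, g ≫ p n = g' ≫ p n) : g = g' := by
    let G : Comon.mk X ⟶ K := Comon.Hom.mk g
    let G' : Comon.mk X ⟶ K := Comon.Hom.mk g'
    suffices G = G' from congrArg Comon.Hom.hom this
    refine (adj.homEquiv (Comon.mk X) P).symm.injective (Pi.hom_ext _ _ fun n ↦ ?_)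
    rw [adj.homEquiv_counit, adj.homEquiv_counit, Category.assoc, Category.assoc]
    exact h n
  obtain ⟨T, hT, i, hi, hic, hir, hiu⟩ := exists_universal_equalizing_subcomonoid h_colim h_fact
    h_wp h_mono (InverseSeqRel p)
  have ht := (isInverseSeq_comp_iff p i).2 hir
  refine ⟨T, hT, fun n ↦ i ≫ p n, ht, fun {X} _ f hf ↦ ?_, fun {X} _ h h' hh hh' e ↦ ?_⟩
  · obtain ⟨g, hg, hgf⟩ := hp f
    have : f = fun n ↦ g ≫ p n := funext fun n ↦ (hgf n).symm
    subst this
    obtain ⟨k, hk⟩ := hiu g ((isInverseSeq_comp_iff p g).1 hf)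
    subst hk
    exact ⟨k, .of_comp_mono h_mono k i, (Category.assoc _ _ _).symm⟩
  · rw [← cancel_mono i]
    refine hp' _ _ inferInstance inferInstance fun n ↦ ?_
    rw [Category.assoc, Category.assoc]
    -- Agreement at index 0 propagates to every index by uniqueness of inverses.
    exact congrFun ((ht.precomp h).ext (ht.precomp h') e) n

/-- The candidate terms are now the iterates of `shift` on T itself, so no cofree comonoid is needed
and s 0 is the inclusion of a subcomonoid. -/
lemma IsUniversalInverseSeq.exists_mono {T B : C} [BimonObj T] [BimonObj B] {t : ℕ → (T ⟶ B)}
    (ht : IsUniversalInverseSeq t) [IsBimonHom (t 0)]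
    (h_colim : HasColimitsOfSize.{w, w} C) (h_fact : ExtrEpiMonoStructured C)
    (h_wp : IsWellpowered.{w} C) (h_mono : TensorPreservesMono C) :
    ∃ (E : C) (_ : ComonObj E) (s : ℕ → (E ⟶ T)), IsUniversalInverseSeq s ∧ Mono (s 0) := by
  obtain ⟨E, hE, i, hi, hic, hir, hiu⟩ := exists_universal_equalizing_subcomonoid h_colim h_fact
    h_wp h_mono (InverseSeqRel ht.shiftIter)
  have h₀ : i ≫ ht.shiftIter 0 = i := Category.comp_id i
  refine ⟨E, hE, fun n ↦ i ≫ ht.shiftIter n, ⟨(isInverseSeq_comp_iff _ i).2 hir,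
    fun {X} _ f hf ↦ ?_, fun {X} _ h h' _ _ e ↦ ?_⟩, show Mono (i ≫ ht.shiftIter 0) by rwa [h₀]⟩
  · have := hf.isComonHom
    obtain ⟨k, hk⟩ := hiu (f 0) ((isInverseSeq_comp_iff _ _).1 (by
      rwa [← funext (ht.isInverseSeq_eq hf)]))
    have : IsComonHom (k ≫ i) := by rwa [hk]
    exact ⟨k, .of_comp_mono h_mono k i, by rw [h₀, hk]⟩
  · rwa [h₀, cancel_mono] at e

lemma exists_cofree_hopfObj [HasCountableProducts C]
    (h_colim : HasColimitsOfSize.{w, w} C) (h_fact : ExtrEpiMonoStructured C)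
    (h_wp : IsWellpowered.{w} C) (h_mono : TensorPreservesMono C)
    (h_cofree : (Comon.forget C).IsLeftAdjoint) (B : C) [BimonObj B] :
    ∃ (E : C) (_ : HopfObj E) (p : E ⟶ B), IsBimonHom p ∧
      ∀ {H : C} [HopfObj H] (f : H ⟶ B) [IsBimonHom f], ∃! h : H ⟶ E, IsBimonHom h ∧ h ≫ p = f := by
  obtain ⟨T, _, t, ht⟩ := exists_isUniversalInverseSeq h_colim h_fact h_wp h_mono h_cofree B
  let := ht.bimonObj
  have := ht.isBimonHom_zero
  obtain ⟨E, _, s, hs, _⟩ := ht.exists_mono h_colim h_fact h_wp h_mono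
  let := hs.hopfObj
  have : IsBimonHom (s 0) := hs.isBimonHom_zero
  refine ⟨E, inferInstance, s 0 ≫ t 0, ⟨⟩, fun {H} _ f _ ↦ ?_⟩
  obtain ⟨g, hg, hgf⟩ := ht.exists_isBimonHom f
  obtain ⟨h, hh, hhg⟩ := hs.exists_isBimonHom g
  refine ⟨h, ⟨hh, by rw [reassoc_of% hhg, hgf]⟩, fun k ⟨hk, hkf⟩ ↦ ?_⟩
  refine hs.hom_ext _ _ hk.toIsComonHom hh.toIsComonHom ?_
  refine ht.hom_ext _ _ inferInstance inferInstance ?_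
  rw [Category.assoc, hkf, hhg, hgf]

end Universal

/-! ### The coreflection, via terminal costructured arrows -/

section Coreflection

variable {C : Type u} [Category.{v} C] [MonoidalCategory C] [BraidedCategory C]

lemma Bimon.isBimonHom_hom {M N : Bimon C} (f : M ⟶ N) : IsBimonHom f.hom.hom where
  one_hom := f.hom.isMonHom_hom.one_hom
  mul_hom := f.hom.isMonHom_hom.mul_hom
  hom_counit := congrArg Mon.Hom.hom f.isComonHom_hom.hom_counit
  hom_comul := congrArg Mon.Hom.hom f.isComonHom_hom.hom_comul

/-- The morphism of `Bimon C` given by a morphism of bimonoid objects. -/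
def Bimon.homMk {M N : Bimon C} (f : M.X.X ⟶ N.X.X) [h : IsBimonHom f] : M ⟶ N :=
  Comon.Hom.mk' (Mon.Hom.mk f) (Mon.Hom.ext h.hom_counit) (Mon.Hom.ext h.hom_comul)

lemma Hopf.isBimonHom_hom (H : Hopf C) {B : Bimon C} (f : H.toBimon ⟶ B) :
    IsBimonHom (M := H.X) f.hom.hom :=
  Bimon.isBimonHom_hom f

/-- The morphism of `Bimon C` given by a bimonoid morphism out of a Hopf monoid. -/
def Hopf.homMk (H : Hopf C) {B : Bimon C} (f : H.X ⟶ B.X.X) (h : IsBimonHom f) : H.toBimon ⟶ B :=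
  Bimon.homMk (M := H.toBimon) (h := h) f

instance : (hopfForgetToBimon C).Full := inferInstanceAs (inducedFunctor Hopf.toBimon).Full

instance : (hopfForgetToBimon C).Faithful := inferInstanceAs (inducedFunctor Hopf.toBimon).Faithful

lemma isLeftAdjoint_hopfForgetToBimon (h_colim : HasColimitsOfSize.{w, w} C)
    [HasCountableProducts C] (h_fact : ExtrEpiMonoStructured C) (h_wp : IsWellpowered.{w} C)
    (h_mono : TensorPreservesMono C) (h_cofree : (Comon.forget C).IsLeftAdjoint) :
    (hopfForgetToBimon C).IsLeftAdjoint := by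
  refine isLeftAdjoint_iff_hasTerminal_costructuredArrow.2 fun B ↦ ?_
  obtain ⟨E, _, p, hp, hE⟩ := exists_cofree_hopfObj h_colim h_fact h_wp h_mono h_cofree B.X.X
  let A : CostructuredArrow (hopfForgetToBimon C) B :=
    CostructuredArrow.mk (Y := Hopf.mk E) (Hopf.homMk ⟨E⟩ p hp)
  have hA (Z : CostructuredArrow (hopfForgetToBimon C) B) : Nonempty (Unique (Z ⟶ A)) := by
    obtain ⟨h, ⟨hh, hhp⟩, hu⟩ := @hE Z.left.X _ Z.hom.hom.hom (Hopf.isBimonHom_hom _ Z.hom)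
    let k : Z.left ⟶ Hopf.mk E :=
      (hopfForgetToBimon C).preimage (Hopf.homMk Z.left (B := Hopf.toBimon ⟨E⟩) h hh)
    have hk : (hopfForgetToBimon C).map k = Hopf.homMk Z.left (B := Hopf.toBimon ⟨E⟩) h hh :=
      (hopfForgetToBimon C).map_preimage _
    refine ⟨⟨⟨CostructuredArrow.homMk k ?_⟩, fun m ↦ ?_⟩⟩
    · rw [hk]
      exact Bimon.ext hhp
    · ext1
      refine (hopfForgetToBimon C).map_injective ?_
      refine Eq.trans (Bimon.ext ?_) hk.symm
      refine hu _ ⟨Hopf.isBimonHom_hom Z.left ((hopfForgetToBimon C).map m.left), ?_⟩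
      exact congrArg (fun x : Z.left.toBimon ⟶ B ↦ x.hom.hom) (CostructuredArrow.w m)
  exact (IsTerminal.ofUniqueHom (fun Z ↦ (hA Z).some.default)
    fun Z m ↦ (hA Z).some.uniq m).hasTerminal

end Coreflection

end CategoryTheory

theorem mainTheorem3 (C : Type u) [Category.{v} C] [MonoidalCategory C] [BraidedCategory C]
    (h_colim : HasColimitsOfSize.{w, w} C)
    (h_lim : HasFiniteLimits C ∧ HasCountableLimits C)
    (h_fact : ExtrEpiMonoStructured C)
    (h_wp : IsWellpowered.{w} C)
    (h_mono : TensorPreservesMono C)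
    (h_cofree : (Comon.forget C).IsLeftAdjoint) :
    (∃ H_r : Bimon C ⥤ Hopf C, Nonempty (hopfForgetToBimon C ⊣ H_r)) ∧
      Nonempty (Coreflective (hopfForgetToBimon C)) := by
  have := h_lim.2
  have := isLeftAdjoint_hopfForgetToBimon h_colim h_fact h_wp h_mono h_cofree
  let adj := Adjunction.ofIsLeftAdjoint (hopfForgetToBimon C)
  exact ⟨⟨_, ⟨adj⟩⟩, ⟨{ R := _, adj := adj }⟩⟩
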